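/- Let $S\subset\mathbb R^n$ be a nonempty closed convex set and let $d:\mathbb R^n\times\mathbb R^n\to[0,\infty]$ be a proximal distance with respect to $S$, i.e., for every $y\in\operatorname{int}S$: $d(\cdot,y)$ is proper, lower semicontinuous, convex, and $C^1$ on $\operatorname{int}S$; $\operatorname{dom}d(\cdot,y)\subset S$; and the domain of the subdifferential map $\partial_1 d(\cdot,y)$ equals $\operatorname{int}S$. Write $\nabla_1 d(x,y)$ for the gradient of $d(\cdot,y)$ at $x$. Let $K\subset\mathbb R^n$ be closed and convex with $K\subset\operatorname{int}(\operatorname{dom}d(\cdot,y))$ for all $y\in\operatorname{int}S$, let $\bar x\in K\cap\operatorname{int}S$, and let $\varepsilon,\lambda>0$. Let $f,h:K\times K\to\mathbb R$ be such that each $\psi\in\{f,h\}$ satisfies, for all $x,y\in K$: - (L1) $\psi(x,x)=0$; - (L2) $\psi(\cdot,y):K\to\mathbb R$ is upper semicontinuous; - (L3) $\psi(x,\cdot):K\to\mathbb R$ is convex and lower semicontinuous; - (L4) $\psi(x,y)+\psi(y,x)\le 0$. Put $g=\varepsilon f+h$ and $$\bar f(x,y)=g(x,y)+\lambda^{-1}\langle\nabla_1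 d(x,\bar x),\,y-x\rangle,\qquad x,y\in K,$$ and let $S(\bar f,K)=\{u\in K:\ \bar f(u,y)\ge 0\ \text{for all } y\in K\}$. Consider the condition - (L6) for every sequence $(y^k)\subset K$ with $\|y^k\|\to\infty$, $\ \displaystyle\liminf_{k\to\infty}\bigl[g(\bar x,y^k)+\lambda^{-1}\langle\nabla_1 d(y^k,\bar x),\,y^k-\bar x\rangle\bigr]>0$. Then: (i) if (L6) holds, then $S(\bar f,K)$ is nonempty; (ii) if $\nabla_1 d(\cdot,\bar x)$ is strictly monotone on $K$, i.e., $\langle\nabla_1 d(x,\bar x)-\nabla_1 d(y,\bar x),\,x-y\rangle>0$ for all $x\ne y$ in $K$, then $S(\bar f,K)$ has at most one element. Consequently, if (L6) holds and $\nabla_1 d(\cdot,\bar x)$ is strictly monotone on $K$, then $S(\bar f,K)$ has exactly one element. -/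

import Mathlib

open Set Filter Topology
open scoped NNReal ENNReal RealInnerProductSpace

noncomputable section

/-- Euclidean space `ℝⁿ`. -/
abbrev Rn (n : ℕ) : Type := EuclideanSpace ℝ (Fin n)

/-- The effective domain of a function with values in `[0, ∞]`. -/
def effDomain {n : ℕ} (φ : Rn n → ℝ≥0∞) : Set (Rn n) := {x | φ x ≠ ⊤}

/-- The classical subdifferential of `φ : ℝⁿ → [0, ∞]` at `x` (empty where `φ x = ∞`). -/
def convexSubdifferential {n : ℕ} (φ : Rn n → ℝ≥0∞) (x : Rn n) : Set (Rn n) :=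
  {v | φ x ≠ ⊤ ∧ ∀ z, (φ x : EReal) + ((⟪v, z - x⟫ : ℝ) : EReal) ≤ (φ z : EReal)}

/-- The domain of the subdifferential map of `φ`. -/
def domSubdifferential {n : ℕ} (φ : Rn n → ℝ≥0∞) : Set (Rn n) :=
  {x | (convexSubdifferential φ x).Nonempty}

/-- `d : ℝⁿ × ℝⁿ → [0, ∞]` is a proximal distance with respect to the nonempty closed convex
set `S`. (As `d` is nonnegative, `d(·, y)` is proper as soon as it is somewhere finite; convexity
of a `[0, ∞]`-valued function is expressed with nonnegative real weights.) -/
structure IsProximalDistance {n : ℕ} (d : Rn n → Rn n → ℝ≥0∞) (S : Set (Rn n)) : Prop where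
  nonempty : S.Nonempty
  isClosed : IsClosed S
  convex : Convex ℝ S
  proper : ∀ y ∈ interior S, (effDomain fun x => d x y).Nonempty
  lsc : ∀ y ∈ interior S, LowerSemicontinuous fun x => d x y
  convexOn : ∀ y ∈ interior S, ConvexOn ℝ≥0 univ fun x => d x y
  contDiffOn : ∀ y ∈ interior S, ContDiffOn ℝ 1 (fun x => (d x y).toReal) (interior S)
  dom_subset : ∀ y ∈ interior S, (effDomain fun x => d x y) ⊆ S
  dom_subdifferential : ∀ y ∈ interior S, (domSubdifferential fun x => d x y) = interior S

/-- `∇₁ d(x, y)`: the gradient at `x` of `d(·, y)`, read as a real-valued function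
near a point in the interior of its effective domain. -/
def gradFst {n : ℕ} (d : Rn n → Rn n → ℝ≥0∞) (x y : Rn n) : Rn n :=
  gradient (fun z => (d z y).toReal) x

/-- Condition (L1): `ψ(x, x) = 0` on `K`. -/
def CondL1 {n : ℕ} (K : Set (Rn n)) (ψ : Rn n → Rn n → ℝ) : Prop :=
  ∀ x ∈ K, ψ x x = 0

/-- Condition (L2): `ψ(·, y)` is upper semicontinuous on `K`, for each `y ∈ K`. -/
def CondL2 {n : ℕ} (K : Set (Rn n)) (ψ : Rn n → Rn n → ℝ) : Prop :=
  ∀ y ∈ K, UpperSemicontinuousOn (fun x => ψ x y) K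

/-- Condition (L3): `ψ(x, ·)` is convex and lower semicontinuous on `K`, for each `x ∈ K`. -/
def CondL3 {n : ℕ} (K : Set (Rn n)) (ψ : Rn n → Rn n → ℝ) : Prop :=
  ∀ x ∈ K, ConvexOn ℝ K (fun y => ψ x y) ∧ LowerSemicontinuousOn (fun y => ψ x y) K

/-- Condition (L4): `ψ(x, y) + ψ(y, x) ≤ 0` on `K`. -/
def CondL4 {n : ℕ} (K : Set (Rn n)) (ψ : Rn n → Rn n → ℝ) : Prop :=
  ∀ x ∈ K, ∀ y ∈ K, ψ x y + ψ y x ≤ 0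

/-- The solution set `S(ψ, K)` of the equilibrium problem. -/
def equilibriumSet {n : ℕ} (ψ : Rn n → Rn n → ℝ) (K : Set (Rn n)) : Set (Rn n) :=
  {u | u ∈ K ∧ ∀ y ∈ K, 0 ≤ ψ u y}

/-- The regularized bifunction
`f̄(x, y) = ε f(x, y) + h(x, y) + λ⁻¹ ⟨∇₁ d(x, x̄), y - x⟩` (with `lam` for `λ`). -/
def regularizedBifunction {n : ℕ} (f h : Rn n → Rn n → ℝ) (d : Rn n → Rn n → ℝ≥0∞)
    (ε lam : ℝ) (xbar : Rn n) (x y : Rn n) : ℝ :=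
  ε * f x y + h x y + lam⁻¹ * ⟪gradFst d x xbar, y - x⟫

/-- Condition (L6), with `g = ε f + h`: for every sequence `yᵏ ∈ K` with `‖yᵏ‖ → ∞`,
`liminf (g(x̄, yᵏ) + λ⁻¹ ⟨∇₁ d(yᵏ, x̄), yᵏ - x̄⟩) > 0`, the lower limit being
taken in the extended reals. -/
def CondL6 {n : ℕ} (K : Set (Rn n)) (f h : Rn n → Rn n → ℝ) (d : Rn n → Rn n → ℝ≥0∞)
    (ε lam : ℝ) (xbar : Rn n) : Prop :=
  ∀ y : ℕ → Rn n, (∀ k, y k ∈ K) → Tendsto (fun k => ‖y k‖) atTop atTop →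
    (0 : EReal) < liminf (fun k => ((ε * f xbar (y k) + h xbar (y k)
      + lam⁻¹ * ⟪gradFst d (y k) xbar, y k - xbar⟫ : ℝ) : EReal)) atTop

/-- Strict monotonicity on `K` of a map `T` into `ℝⁿ`. -/
def StrictlyMonotoneOn {n : ℕ} (T : Rn n → Rn n) (K : Set (Rn n)) : Prop :=
  ∀ x ∈ K, ∀ y ∈ K, x ≠ y → 0 < ⟪T x - T y, x - y⟫

end

/-!
The bifunction `f̄` is monotone, because `f` and `h` are and because the gradient of the convex
function `d(·, x̄)` is a monotone map; it is upper semicontinuous in its first variable, because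
that gradient is continuous on `int S ⊇ K`. Monotonicity makes the existence theory elementary:
no fixed point theorem is needed.

On a compact convex set `C` one first solves the dual (Minty) problem `G(y, x) ≤ 0` for all `y ∈
C`. The sets `{x ∈ C : G(y, x) ≤ δ}` with `δ > 0` are compact, so it is enough that finitely many
of them meet. If they did not, the Hahn-Banach theorem in `ℝᵐ` would give weights `wᵢ ≥ 0` with
sum `1` and `∑ wᵢ G(yᵢ, x) ≥ ∑ wᵢ δᵢ > 0` for all `x ∈ C`; but at `x = ∑ wⱼ yⱼ` convexity bounds
the left side by `∑ wᵢ wⱼ G(yᵢ, yⱼ)`, which is at most `0` by monotonicity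
(`exists_forall_le_of_convexOn`, `exists_forall_le_of_monotone`). Convexity along segments and
upper semicontinuity turn a dual solution into a solution (`nonneg_of_forall_swap_nonpos`).

On an unbounded `K` the problem is solved on `K ∩ closedBall x̄ R`. Testing a solution `u` with
`y = x̄` and using monotonicity of `g` gives `g(x̄, u) + λ⁻¹ ⟨∇₁ d(u, x̄), u - x̄⟩ ≤ 0`, which by
(L6) bounds `u` independently of `R`. For large `R` the point `u` is thus interior to the ball,
and convexity extends the inequality `f̄(u, y) ≥ 0` from the ball to all of `K`.

Uniqueness: two solutions `u ≠ v` would give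
`0 ≤ f̄(u, v) + f̄(v, u) ≤ -λ⁻¹ ⟨∇₁ d(u, x̄) - ∇₁ d(v, x̄), u - v⟩ < 0`.
-/

/-! ### Monotone equilibrium problems on compact convex sets -/

/-- A quadratic form `∑ wᵢ wⱼ aᵢⱼ` with nonnegative weights is nonpositive when
`aᵢⱼ + aⱼᵢ ≤ 0`. -/
lemma sum_mul_sum_mul_nonpos {ι : Type*} [Fintype ι] {w : ι → ℝ} (hw : ∀ i, 0 ≤ w i)
    {a : ι → ι → ℝ} (ha : ∀ i j, a i j + a j i ≤ 0) :
    ∑ i, w i * ∑ j, w j * a i j ≤ 0 := by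
  have h1 : ∑ i, w i * ∑ j, w j * a i j = ∑ i, ∑ j, w i * w j * a i j := by
    simp only [Finset.mul_sum, mul_assoc]
  have h2 : ∑ i, ∑ j, w i * w j * a i j = ∑ i, ∑ j, w i * w j * a j i := by
    rw [Finset.sum_comm]
    simp only [mul_comm]
  have h3 : ∑ i, ∑ j, w i * w j * (a i j + a j i) ≤ 0 :=
    Finset.sum_nonpos fun i _ => Finset.sum_nonpos fun j _ =>
      mul_nonpos_of_nonneg_of_nonpos (mul_nonneg (hw i) (hw j)) (ha i j)
  simp only [mul_add, Finset.sum_add_distrib] at h3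
  linarith

/-- A theorem of the alternative for finitely many convex functions: if every convex combination
of the `φ i - δ i` is somewhere negative, then they are all nonpositive at a common point.
Otherwise the open box `{z | ∀ i, z i < δ i}` could be separated from the convex set of upper
bounds of the vectors `(φ i x)`, `x ∈ C`; the coefficients of the separating functional, which
are nonnegative, would be the weights of a convex combination that is nowhere negative. -/
lemma exists_forall_le_of_convexOn {E ι : Type*} [AddCommGroup E] [Module ℝ E] [Fintype ι]
    {C : Set E} (hC : C.Nonempty) {φ : ι → E → ℝ} (hφ : ∀ i, ConvexOn ℝ C (φ i)) {δ : ι → ℝ}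
    (h : ∀ w : ι → ℝ, (∀ i, 0 ≤ w i) → ∑ i, w i = 1 →
      ∃ x ∈ C, ∑ i, w i * φ i x < ∑ i, w i * δ i) :
    ∃ x ∈ C, ∀ i, φ i x ≤ δ i := by
  classical
  by_contra! hcon
  obtain ⟨c, hc⟩ := hC
  let A : Set (ι → ℝ) := {z | ∃ x ∈ C, ∀ i, φ i x ≤ z i}
  let B : Set (ι → ℝ) := Set.pi univ fun i => Iio (δ i)
  have hA : Convex ℝ A := by
    rintro z ⟨x, hx, hxz⟩ z' ⟨x', hx', hxz'⟩ a b ha hb hab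
    refine ⟨a • x + b • x', (hφ (hcon c hc).choose).1 hx hx' ha hb hab, fun i => ?_⟩
    refine ((hφ i).2 hx hx' ha hb hab).trans ?_
    simp only [smul_eq_mul, Pi.add_apply, Pi.smul_apply]
    exact add_le_add (mul_le_mul_of_nonneg_left (hxz i) ha)
      (mul_le_mul_of_nonneg_left (hxz' i) hb)
  have hB : Convex ℝ B := convex_pi fun i _ => convex_Iio (δ i)
  have hBo : IsOpen B := isOpen_set_pi finite_univ fun i _ => isOpen_Iio
  have hdisj : Disjoint B A := by
    rw [Set.disjoint_left]
    rintro z hzB ⟨x, hx, hxz⟩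
    obtain ⟨i, hi⟩ := hcon x hx
    exact absurd (hi.trans_le (hxz i)) (not_lt.2 (hzB i (mem_univ i)).le)
  obtain ⟨F, u, hFB, hFA⟩ := geometric_hahn_banach_open hB hBo hA hdisj
  let v : ι → ℝ := fun i => F (Pi.single i 1)
  have hF : ∀ z : ι → ℝ, F z = ∑ i, v i * z i := by
    intro z
    conv_lhs => rw [pi_eq_sum_univ' z]
    simp [v, mul_comm]
  -- `A` is stable under increasing a coordinate, so `F` is bounded below along `Pi.single i 1`.
  have hv : ∀ i, 0 ≤ v i := by
    intro i
    by_contra! hi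
    have hmem : ∀ t : ℝ, 0 ≤ t → (fun j => φ j c) + t • Pi.single i (1 : ℝ) ∈ A := by
      intro t ht
      refine ⟨c, hc, fun j => ?_⟩
      have : 0 ≤ (Pi.single i (1 : ℝ) : ι → ℝ) j := by
        by_cases hj : j = i
        · subst hj; simp
        · simp [hj]
      simpa using mul_nonneg ht this
    have h0 := hFA _ (hmem 0 le_rfl)
    have h1 := hFA _ (hmem ((F (fun j => φ j c) - u + 1) / (-v i))
      (div_nonneg (by simp at h0; linarith) (by linarith)))
    rw [map_add, map_smul, smul_eq_mul] at h1
    change u ≤ _ + _ * v i at h1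
    have : (F (fun j => φ j c) - u + 1) / (-v i) * v i = -(F (fun j => φ j c) - u + 1) := by
      field_simp [hi.ne]
    linarith
  have hFδ : F δ ≤ u := by
    have hδ : δ ∈ closure B := by
      rw [closure_pi_set]
      intro i _
      simp
    exact closure_minimal (fun b hb => (hFB b hb).le) (isClosed_le F.continuous continuous_const) hδ
  have hs : 0 < ∑ i, v i := by
    refine (Finset.sum_nonneg fun i _ => hv i).lt_of_ne fun h0 => ?_
    have hv0 : ∀ i, v i = 0 := fun i =>
      (Finset.sum_eq_zero_iff_of_nonneg fun i _ => hv i).1 h0.symm i (Finset.mem_univ i)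
    have hF0 : ∀ z, F z = 0 := fun z => by simp [hF, hv0]
    have h1 := hFB (fun i => δ i - 1) (fun i _ => by simp)
    have h2 := hFA (fun i => φ i c) ⟨c, hc, fun i => le_rfl⟩
    rw [hF0] at h1 h2
    linarith
  obtain ⟨x, hx, hlt⟩ := h (fun i => v i / ∑ j, v j) (fun i => div_nonneg (hv i) hs.le)
    (by rw [← Finset.sum_div, div_self hs.ne'])
  have h1 := hFA (fun i => φ i x) ⟨x, hx, fun i => le_rfl⟩
  rw [hF] at h1 hFδ
  simp only [div_mul_eq_mul_div, ← Finset.sum_div] at hlt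
  rw [div_lt_div_iff_of_pos_right hs] at hlt
  linarith

/-- The finite intersection property behind the Minty problem: finitely many of the sets
`{x ∈ C : G(y, x) ≤ δ}` have a common point. -/
lemma exists_forall_le_of_monotone {E ι : Type*} [AddCommGroup E] [Module ℝ E] [Fintype ι]
    {C : Set E} (hC : Convex ℝ C) (hne : C.Nonempty) {G : E → E → ℝ}
    (hconv : ∀ x ∈ C, ConvexOn ℝ C (G x))
    (hmono : ∀ x ∈ C, ∀ y ∈ C, G x y + G y x ≤ 0)
    {y : ι → E} (hy : ∀ i, y i ∈ C) {δ : ι → ℝ} (hδ : ∀ i, 0 < δ i) :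
    ∃ x ∈ C, ∀ i, G (y i) x ≤ δ i := by
  refine exists_forall_le_of_convexOn hne (fun i => hconv (y i) (hy i)) fun w hw hw1 => ?_
  refine ⟨∑ j, w j • y j, hC.sum_mem (fun i _ => hw i) hw1 fun i _ => hy i, ?_⟩
  have hle : ∑ i, w i * G (y i) (∑ j, w j • y j) ≤ ∑ i, w i * ∑ j, w j * G (y i) (y j) :=
    Finset.sum_le_sum fun i _ => mul_le_mul_of_nonneg_left
      ((hconv (y i) (hy i)).map_sum_le (fun j _ => hw j) hw1 fun j _ => hy j) (hw i)
  have hpos : 0 < ∑ i, w i * δ i := by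
    obtain ⟨i, -, hi⟩ : ∃ i ∈ Finset.univ, 0 < w i := by
      by_contra! hcon
      linarith [Finset.sum_nonpos hcon]
    exact Finset.sum_pos' (fun j _ => mul_nonneg (hw j) (hδ j).le)
      ⟨i, Finset.mem_univ i, mul_pos hi (hδ i)⟩
  exact (hle.trans (sum_mul_sum_mul_nonpos hw fun i j => hmono _ (hy i) _ (hy j))).trans_lt hpos

/-- A monotone bifunction on a compact convex set has a solution of the dual (Minty) equilibrium
problem. -/
lemma exists_forall_swap_nonpos {E : Type*} [AddCommGroup E] [Module ℝ E] [TopologicalSpace E]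
    [T2Space E] {C : Set E} (hC : Convex ℝ C) (hcomp : IsCompact C) (hne : C.Nonempty)
    {G : E → E → ℝ} (hconv : ∀ x ∈ C, ConvexOn ℝ C (G x))
    (hlsc : ∀ x ∈ C, LowerSemicontinuousOn (G x) C)
    (hmono : ∀ x ∈ C, ∀ y ∈ C, G x y + G y x ≤ 0) :
    ∃ x ∈ C, ∀ y ∈ C, G y x ≤ 0 := by
  have hclosed : ∀ p : C × Ioi (0 : ℝ), IsClosed (C ∩ G p.1 ⁻¹' Iic (p.2 : ℝ)) := fun p =>
    ((hlsc p.1 p.1.2).isCompact_inter_preimage_Iic hcomp _).isClosed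
  obtain ⟨x, hx, hxp⟩ := hcomp.inter_iInter_nonempty _ hclosed fun s => by
    obtain ⟨x, hx, hxs⟩ := exists_forall_le_of_monotone (ι := s) hC hne hconv hmono
      (y := fun p => (p.1.1 : E)) (fun p => p.1.1.2) (δ := fun p => (p.1.2 : ℝ))
      (fun p => p.1.2.2)
    exact ⟨x, hx, mem_iInter₂.2 fun p hp => ⟨hx, hxs ⟨p, hp⟩⟩⟩
  refine ⟨x, hx, fun y hy => le_of_forall_pos_le_add fun δ hδ => ?_⟩
  simpa using (mem_iInter.1 hxp (⟨y, hy⟩, ⟨δ, hδ⟩)).2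

/-- Minty's lemma for bifunctions: a solution of the dual problem solves the equilibrium
problem. -/
lemma nonneg_of_forall_swap_nonpos {E : Type*} [AddCommGroup E] [Module ℝ E] [TopologicalSpace E]
    [ContinuousAdd E] [ContinuousSMul ℝ E] {C : Set E} (hC : Convex ℝ C)
    {G : E → E → ℝ} (hdiag : ∀ x ∈ C, G x x = 0) (hconv : ∀ x ∈ C, ConvexOn ℝ C (G x))
    (husc : ∀ y ∈ C, UpperSemicontinuousOn (fun x => G x y) C)
    {x : E} (hx : x ∈ C) (hdual : ∀ y ∈ C, G y x ≤ 0) {y : E} (hy : y ∈ C) :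
    0 ≤ G x y := by
  by_contra! hlt
  have hmem : ∀ t ∈ Ioo (0 : ℝ) 1, (1 - t) • x + t • y ∈ C := fun t ht =>
    hC hx hy (by linarith [ht.2]) ht.1.le (by ring)
  have hseg : ∀ t ∈ Ioo (0 : ℝ) 1, 0 ≤ G ((1 - t) • x + t • y) y := by
    intro t ht
    have h1 := (hconv _ (hmem t ht)).2 hx hy (by linarith [ht.2] : (0 : ℝ) ≤ 1 - t) ht.1.le
      (by ring)
    rw [hdiag _ (hmem t ht), smul_eq_mul, smul_eq_mul] at h1
    have h2 := mul_nonpos_of_nonneg_of_nonpos (by linarith [ht.2] : (0 : ℝ) ≤ 1 - t)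
      (hdual _ (hmem t ht))
    exact nonneg_of_mul_nonneg_right (by linarith) ht.1
  have hlim : Tendsto (fun t : ℝ => (1 - t) • x + t • y) (𝓝[>] 0) (𝓝[C] x) := by
    refine tendsto_nhdsWithin_iff.2 ⟨?_, ?_⟩
    · have hc : Continuous fun t : ℝ => (1 - t) • x + t • y := by fun_prop
      have := (hc.tendsto 0).mono_left (nhdsWithin_le_nhds (s := Ioi 0))
      simpa using this
    · filter_upwards [Ioo_mem_nhdsGT (zero_lt_one' ℝ)] with t ht using hmem t ht
  have hev := hlim.eventually (upperSemicontinuousOn_iff.1 (husc y hy) x hx 0 hlt)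
  obtain ⟨t, ht1, ht2⟩ := (hev.and (Ioo_mem_nhdsGT (zero_lt_one' ℝ))).exists
  exact absurd (hseg t ht2) (not_le.2 ht1)

/-! ### Gradients of convex functions -/

/-- The gradient inequality for a convex function. -/
lemma ConvexOn.inner_gradient_le {E : Type*} [NormedAddCommGroup E] [InnerProductSpace ℝ E]
    [CompleteSpace E] {U : Set E} {φ : E → ℝ} (hφ : ConvexOn ℝ U φ) {x y : E} (hx : x ∈ U)
    (hy : y ∈ U) (hd : DifferentiableAt ℝ φ x) :
    ⟪gradient φ x, y - x⟫ ≤ φ y - φ x := by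
  let L : ℝ →ᵃ[ℝ] E := AffineMap.lineMap x y
  have hconv := hφ.comp_affineMap L
  have hL : HasDerivAt L (y - x) 0 := AffineMap.hasDerivAt_lineMap
  have hder : HasDerivAt (φ ∘ L) ⟪gradient φ x, y - x⟫ 0 := by
    have hg : HasFDerivAt φ (InnerProductSpace.toDual ℝ E (gradient φ x)) (L 0) := by
      simpa [L] using hd.hasGradientAt.hasFDerivAt
    simpa using hg.comp_hasDerivAt (0 : ℝ) hL
  simpa [slope_def_field, L] using
    hconv.le_slope_of_hasDerivAt (x := 0) (y := 1) (by simpa [L]) (by simpa [L]) one_pos hder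

lemma ConvexOn.inner_gradient_sub_nonneg {E : Type*} [NormedAddCommGroup E]
    [InnerProductSpace ℝ E] [CompleteSpace E] {U : Set E} {φ : E → ℝ} (hφ : ConvexOn ℝ U φ)
    {x y : E} (hx : x ∈ U) (hy : y ∈ U) (hdx : DifferentiableAt ℝ φ x)
    (hdy : DifferentiableAt ℝ φ y) :
    0 ≤ ⟪gradient φ x - gradient φ y, x - y⟫ := by
  have h1 := hφ.inner_gradient_le hx hy hdx
  have h2 := hφ.inner_gradient_le hy hx hdy
  rw [← neg_sub x y, inner_neg_right] at h1
  rw [inner_sub_left]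
  linarith

namespace IsProximalDistance

variable {n : ℕ} {d : Rn n → Rn n → ℝ≥0∞} {S : Set (Rn n)} {y : Rn n}

/-- `d(·, y)` is finite on `int S`, because it has a subgradient at every point of `int S`. -/
lemma ne_top (hd : IsProximalDistance d S) (hy : y ∈ interior S) {x : Rn n}
    (hx : x ∈ interior S) : d x y ≠ ⊤ := by
  rw [← hd.dom_subdifferential y hy] at hx
  obtain ⟨v, hv, -⟩ := hx
  exact hv

/-- Convexity with weights in `ℝ≥0` passes to the real-valued function on `int S`, where
`d(·, y)` is finite and `toReal` is therefore monotone and additive. -/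
lemma convexOn_toReal (hd : IsProximalDistance d S) (hy : y ∈ interior S) :
    ConvexOn ℝ (interior S) fun x => (d x y).toReal := by
  refine ⟨hd.convex.interior, fun x hx z hz a b ha hb hab => ?_⟩
  lift a to ℝ≥0 using ha
  lift b to ℝ≥0 using hb
  have h := (hd.convexOn y hy).2 (mem_univ x) (mem_univ z) (zero_le (a := a)) (zero_le (a := b))
    (by exact_mod_cast hab)
  have hfin : a • d x y + b • d z y ≠ ⊤ := by
    simp [ENNReal.smul_def, ENNReal.mul_eq_top, hd.ne_top hy hx, hd.ne_top hy hz]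
  have h' := ENNReal.toReal_mono hfin h
  rwa [ENNReal.toReal_add (by simp [ENNReal.smul_def, ENNReal.mul_eq_top, hd.ne_top hy hx])
    (by simp [ENNReal.smul_def, ENNReal.mul_eq_top, hd.ne_top hy hz]),
    ENNReal.toReal_smul, ENNReal.toReal_smul] at h'

lemma continuousOn_gradFst (hd : IsProximalDistance d S) (hy : y ∈ interior S) :
    ContinuousOn (fun x => gradFst d x y) (interior S) :=
  (InnerProductSpace.toDual ℝ (Rn n)).symm.continuous.comp_continuousOn
    ((hd.contDiffOn y hy).continuousOn_fderiv_of_isOpen isOpen_interior le_rfl)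

lemma inner_gradFst_sub_nonneg (hd : IsProximalDistance d S) (hy : y ∈ interior S) {x z : Rn n}
    (hx : x ∈ interior S) (hz : z ∈ interior S) :
    0 ≤ ⟪gradFst d x y - gradFst d z y, x - z⟫ := by
  have hdiff : ∀ p ∈ interior S, DifferentiableAt ℝ (fun x => (d x y).toReal) p := fun p hp =>
    ((hd.contDiffOn y hy).differentiableOn one_ne_zero).differentiableAt
      (isOpen_interior.mem_nhds hp)
  exact (hd.convexOn_toReal hy).inner_gradient_sub_nonneg hx hz (hdiff x hx) (hdiff z hz)

end IsProximalDistance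

/-! ### The regularized bifunction -/

section Regularized

variable {n : ℕ} {K : Set (Rn n)} {d : Rn n → Rn n → ℝ≥0∞} {f h : Rn n → Rn n → ℝ}
  {ε lam : ℝ} {xbar : Rn n}

lemma regularizedBifunction_self (hf1 : CondL1 K f) (hh1 : CondL1 K h) {x : Rn n} (hx : x ∈ K) :
    regularizedBifunction f h d ε lam xbar x x = 0 := by
  simp [regularizedBifunction, hf1 x hx, hh1 x hx]

/-- The monotonicity estimate used both for existence and for uniqueness. -/
lemma regularizedBifunction_add_swap_le (hf4 : CondL4 K f) (hh4 : CondL4 K h) (hε : 0 < ε)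
    {x y : Rn n} (hx : x ∈ K) (hy : y ∈ K) :
    regularizedBifunction f h d ε lam xbar x y + regularizedBifunction f h d ε lam xbar y x
      ≤ -(lam⁻¹ * ⟪gradFst d x xbar - gradFst d y xbar, x - y⟫) := by
  have hin : ⟪gradFst d x xbar, y - x⟫ = -⟪gradFst d x xbar, x - y⟫ := by
    rw [← inner_neg_right, neg_sub]
  have hfε := mul_nonpos_of_nonneg_of_nonpos hε.le (hf4 x hx y hy)
  have hhxy := hh4 x hx y hy
  simp only [regularizedBifunction, inner_sub_left, hin]
  linarith

lemma regularizedBifunction_upperSemicontinuousOn (hf2 : CondL2 K f) (hh2 : CondL2 K h)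
    (hε : 0 < ε) (hgrad : ContinuousOn (fun x => gradFst d x xbar) K) {y : Rn n} (hy : y ∈ K) :
    UpperSemicontinuousOn (fun x => regularizedBifunction f h d ε lam xbar x y) K := by
  have h1 : UpperSemicontinuousOn (fun x => ε * f x y) K :=
    (continuous_const_mul ε).comp_upperSemicontinuousOn (hf2 y hy)
      (fun _ _ hab => mul_le_mul_of_nonneg_left hab hε.le)
  have h2 : ContinuousOn (fun x => lam⁻¹ * ⟪gradFst d x xbar, y - x⟫) K :=
    continuousOn_const.mul (hgrad.inner (continuousOn_const.sub continuousOn_id))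
  exact (h1.add (hh2 y hy)).add h2.upperSemicontinuousOn

lemma regularizedBifunction_lowerSemicontinuousOn (hf3 : CondL3 K f) (hh3 : CondL3 K h)
    (hε : 0 < ε) {x : Rn n} (hx : x ∈ K) :
    LowerSemicontinuousOn (regularizedBifunction f h d ε lam xbar x) K := by
  have h1 : LowerSemicontinuousOn (fun y => ε * f x y) K :=
    (continuous_const_mul ε).comp_lowerSemicontinuousOn (hf3 x hx).2
      (fun _ _ hab => mul_le_mul_of_nonneg_left hab hε.le)
  have h2 : Continuous (fun y => lam⁻¹ * ⟪gradFst d x xbar, y - x⟫) := by fun_prop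
  exact (h1.add (hh3 x hx).2).add h2.continuousOn.lowerSemicontinuousOn

lemma regularizedBifunction_convexOn (hK : Convex ℝ K) (hf3 : CondL3 K f) (hh3 : CondL3 K h)
    (hε : 0 < ε) {x : Rn n} (hx : x ∈ K) :
    ConvexOn ℝ K (regularizedBifunction f h d ε lam xbar x) := by
  have h1 : ConvexOn ℝ K (fun y => lam⁻¹ * ⟪gradFst d x xbar, y - x⟫) := by
    refine ⟨hK, fun y _ z _ a b _ _ hab => le_of_eq ?_⟩
    have : a • y + b • z - x = a • (y - x) + b • (z - x) := by
      rw [smul_sub, smul_sub, sub_add_sub_comm, ← add_smul, hab, one_smul]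
    simp only [this, inner_add_right, inner_smul_right, smul_eq_mul]
    ring
  exact (((hf3 x hx).1.smul hε.le).add (hh3 x hx).1).add h1

/-- (L6) rules out points of large norm at which the expression in (L6) is nonpositive. -/
lemma CondL6.exists_norm_bound (h6 : CondL6 K f h d ε lam xbar) :
    ∃ R : ℝ, ∀ y ∈ K, ε * f xbar y + h xbar y + lam⁻¹ * ⟪gradFst d y xbar, y - xbar⟫ ≤ 0 →
      ‖y‖ ≤ R := by
  by_contra! hcon
  choose y hyK hy0 hyn using fun k : ℕ => hcon k
  have hlim := h6 y hyK (tendsto_atTop_mono (fun k => (hyn k).le) tendsto_natCast_atTop_atTop)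
  refine absurd hlim (not_lt.2 (liminf_le_of_frequently_le' (Frequently.of_forall fun k => ?_)))
  exact_mod_cast hy0 k

/-- A solution of the equilibrium problem on `K ∩ closedBall c R` that lies in the open ball is a
solution on `K`. -/
lemma mem_equilibriumSet_of_mem_ball {G : Rn n → Rn n → ℝ} {c u : Rn n} {R : ℝ}
    (hdiag : G u u = 0) (hconv : ConvexOn ℝ K (G u))
    (hu : u ∈ equilibriumSet G (K ∩ Metric.closedBall c R)) (hball : u ∈ Metric.ball c R) :
    u ∈ equilibriumSet G K := by
  refine ⟨hu.1.1, fun y hy => ?_⟩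
  have hlim : Tendsto (fun t : ℝ => (1 - t) • u + t • y) (𝓝[>] 0) (𝓝 u) := by
    have hc : Continuous fun t : ℝ => (1 - t) • u + t • y := by fun_prop
    have := (hc.tendsto 0).mono_left (nhdsWithin_le_nhds (s := Ioi 0))
    simpa using this
  obtain ⟨t, htball, ht0, ht1⟩ := ((hlim.eventually (Metric.isOpen_ball.mem_nhds hball)).and
    (Ioo_mem_nhdsGT (zero_lt_one' ℝ))).exists
  have h1 : (0 : ℝ) ≤ 1 - t := by linarith
  have h2 := hu.2 _ ⟨hconv.1 hu.1.1 hy h1 ht0.le (by ring), Metric.ball_subset_closedBall htball⟩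
  have h3 := hconv.2 hu.1.1 hy h1 ht0.le (by ring)
  rw [hdiag, smul_zero, zero_add, smul_eq_mul] at h3
  exact nonneg_of_mul_nonneg_right (h2.trans h3) ht0

end Regularized

theorem mainTheorem3 {n : ℕ} (S K : Set (Rn n)) (d : Rn n → Rn n → ℝ≥0∞)
    (hd : IsProximalDistance d S)
    (hKclosed : IsClosed K) (hKconvex : Convex ℝ K)
    (hKdom : ∀ y ∈ interior S, K ⊆ interior (effDomain fun x => d x y))
    (f h : Rn n → Rn n → ℝ)
    (hf1 : CondL1 K f) (hf2 : CondL2 K f) (hf3 : CondL3 K f) (hf4 : CondL4 K f)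
    (hh1 : CondL1 K h) (hh2 : CondL2 K h) (hh3 : CondL3 K h) (hh4 : CondL4 K h)
    (ε lam : ℝ) (hε : 0 < ε) (hlam : 0 < lam)
    (xbar : Rn n) (hxK : xbar ∈ K) (hxS : xbar ∈ interior S) :
    (CondL6 K f h d ε lam xbar →
      (equilibriumSet (regularizedBifunction f h d ε lam xbar) K).Nonempty) ∧
    (StrictlyMonotoneOn (fun x => gradFst d x xbar) K →
      (equilibriumSet (regularizedBifunction f h d ε lam xbar) K).Subsingleton) ∧
    (CondL6 K f h d ε lam xbar → StrictlyMonotoneOn (fun x => gradFst d x xbar) K →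
      ∃! u, u ∈ equilibriumSet (regularizedBifunction f h d ε lam xbar) K) := by
  have hKS : K ⊆ interior S := (hKdom xbar hxS).trans (interior_mono (hd.dom_subset xbar hxS))
  have hlam' : 0 < lam⁻¹ := inv_pos.2 hlam
  have hex : CondL6 K f h d ε lam xbar →
      (equilibriumSet (regularizedBifunction f h d ε lam xbar) K).Nonempty := by
    intro h6
    obtain ⟨R₀, hR₀⟩ := h6.exists_norm_bound
    -- Every `u` with `‖u‖ ≤ R₀` lies in the open ball of radius `R` about `xbar`.
    let R := max 0 (R₀ + ‖xbar‖) + 1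
    have hRpos : 0 ≤ R := by positivity
    let C := K ∩ Metric.closedBall xbar R
    have hCK : C ⊆ K := inter_subset_left
    have hC : Convex ℝ C := hKconvex.inter (convex_closedBall xbar R)
    have hxC : xbar ∈ C := ⟨hxK, Metric.mem_closedBall_self hRpos⟩
    have hconv : ∀ x ∈ C, ConvexOn ℝ C (regularizedBifunction f h d ε lam xbar x) := fun x hx =>
      (regularizedBifunction_convexOn hKconvex hf3 hh3 hε (hCK hx)).subset hCK hC
    obtain ⟨u, hu, hdual⟩ := exists_forall_swap_nonpos hC
      ((isCompact_closedBall xbar R).inter_left hKclosed) ⟨xbar, hxC⟩ hconv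
      (fun x hx => (regularizedBifunction_lowerSemicontinuousOn hf3 hh3 hε (hCK hx)).mono hCK)
      (fun x hx y hy => (regularizedBifunction_add_swap_le hf4 hh4 hε (hCK hx) (hCK hy)).trans
        (neg_nonpos.2 (mul_nonneg hlam'.le
          (hd.inner_gradFst_sub_nonneg hxS (hKS (hCK hx)) (hKS (hCK hy))))))
    have huC : u ∈ equilibriumSet (regularizedBifunction f h d ε lam xbar) C :=
      ⟨hu, fun y hy => nonneg_of_forall_swap_nonpos hC
        (fun x hx => regularizedBifunction_self hf1 hh1 (hCK hx)) hconv
        (fun y hy => (regularizedBifunction_upperSemicontinuousOn hf2 hh2 hε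
          ((hd.continuousOn_gradFst hxS).mono hKS) (hCK hy)).mono hCK) hu hdual hy⟩
    have hnorm : ‖u‖ ≤ R₀ := by
      refine hR₀ u (hCK hu) ?_
      have h1 := huC.2 xbar hxC
      have hin : ⟪gradFst d u xbar, xbar - u⟫ = -⟪gradFst d u xbar, u - xbar⟫ := by
        rw [← inner_neg_right, neg_sub]
      have h2 := mul_nonpos_of_nonneg_of_nonpos hε.le (hf4 xbar hxK u (hCK hu))
      have h3 := hh4 xbar hxK u (hCK hu)
      rw [regularizedBifunction, hin] at h1
      linarith
    have hball : u ∈ Metric.ball xbar R := by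
      rw [mem_ball_iff_norm]
      calc ‖u - xbar‖ ≤ ‖u‖ + ‖xbar‖ := norm_sub_le u xbar
        _ ≤ max 0 (R₀ + ‖xbar‖) := le_max_of_le_right (by linarith)
        _ < R := lt_add_one _
    exact ⟨u, mem_equilibriumSet_of_mem_ball (regularizedBifunction_self hf1 hh1 (hCK hu))
      (regularizedBifunction_convexOn hKconvex hf3 hh3 hε (hCK hu)) huC hball⟩
  have huniq : StrictlyMonotoneOn (fun x => gradFst d x xbar) K →
      (equilibriumSet (regularizedBifunction f h d ε lam xbar) K).Subsingleton := by
    intro hstrict u hu v hv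
    by_contra huv
    have h1 := regularizedBifunction_add_swap_le (d := d) (lam := lam) (xbar := xbar)
      hf4 hh4 hε hu.1 hv.1
    have h2 := mul_pos hlam' (hstrict u hu.1 v hv.1 huv)
    linarith [hu.2 v hv.1, hv.2 u hu.1]
  refine ⟨hex, huniq, fun h6 hstrict => ?_⟩
  obtain ⟨u, hu⟩ := hex h6
  exact ⟨u, hu, fun v hv => huniq hstrict hv hu⟩
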